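/- Let $d,m\ge 0$ and $r\ge 1$ be integers, let $\delta\ge 0$ be real, and let $u_1,\dots,u_m\in\mathbb C^d$ be vectors such that $\sum_{i=1}^m u_iu_i^*\le I$ (that is, $I-\sum_{i=1}^m u_iu_i^*$ is positive semidefinite) and $\|u_i\|^2\le\delta$ for every $i$, where $\|\cdot\|$ is the Euclidean norm. Then $\{1,\dots,m\}$ can be partitioned into $r$ pairwise disjoint (possibly empty) sets $S_1,\dots,S_r$ such that, for every $k\in\{1,\dots,r\}$, $$\Big\|\sum_{i\in S_k}u_iu_i^*\Big\|\le\frac1r\bigl(1+\sqrt{r\delta}\bigr)^2,$$ where $\|\cdot\|$ is the operator norm on $d\times d$ matrices induced by the Euclidean norm on $\mathbb C^d$. -/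

import Mathlib

open scoped ComplexOrder MatrixOrder Matrix.Norms.L2Operator

/-- The rank-one matrix `u u*` of a column vector `u ∈ ℂ^d`; its `(a, b)` entry is
`u a * conj (u b)`. -/
def rankOne {d : ℕ} (u : EuclideanSpace ℂ (Fin d)) : Matrix (Fin d) (Fin d) ℂ :=
  Matrix.vecMulVec (fun a => u a) (fun b => star (u b))

/-! Put `x = (1 + √(rδ))²`. The polynomial `f(z) = ∏_k det(x(1 - ∑ u_i u_i*) + ∑_i z_{i,k} u_i
u_i*)` (`blockDet`) is real stable and affine in each variable. Hence lowering `z_{i,k}` by `r`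
applies `1 - r∂_{i,k}`, and the average of these operators over `k` is `T_i = 1 - ∑_k ∂_{i,k}`. A
partition `c` corresponds to lowering each `z_{i,c(i)}` by `r`. If the shifted `f` is positive on
the orthant with corner `(x, …, x)`, then `x - s ∑_{c(i)=k} u_i u_i*` is nonsingular for `0 ≤ s ≤
r`, so the sum over each part has norm at most `x / r`.

The barrier method shows that `∏ T_i f` is positive on that orthant (`IsAbove.diffOps`). The
barriers `∂_j f / f` decrease in every coordinate by the Rayleigh inequality. They are also convex
along sets of coordinates: restricted to such a line they map the upper half plane to the lower one,
so they are a constant plus partial fractions with nonnegative residues and negative poles. It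
follows that applying `T_i` and raising the coordinates `(i, k)` by `1 + √(rδ)` increases no
barrier.

The average is then replaced by a choice, one index at a time (`exists_shift_isAbove`). If `T_i g`
is positive at the corner, so is `g - r∂_k g` for some `k`; since `∂_k g / g` decreases, this one
point settles the whole orthant. -/

/-! ### Rational functions from the upper to the lower half plane -/

open Polynomial Filter Topology ComplexConjugate in
/-- The leading coefficient of `N / D` at a real root `ρ` of order `k` of `D`, when `N / D` maps the
upper half plane to the closed lower one. -/
theorem im_leading_coeff_nonpos {N E : ℂ[X]} {ρ : ℂ} {k : ℕ} (hρ : ρ.im = 0)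
    (him : ∀ s : ℂ, 0 < s.im →
      (N.eval s * conj (((X - C ρ) ^ k * E).eval s)).im ≤ 0) {v : ℂ} (hv : 0 < v.im) :
    (N.eval ρ * conj (E.eval ρ) * conj v ^ k).im ≤ 0 := by
  have hc : Continuous fun ε : ℝ =>
      (N.eval (ρ + ε * v) * conj (E.eval (ρ + ε * v)) * conj v ^ k).im := by
    refine Complex.continuous_im.comp ?_
    refine (Continuous.mul ?_ ?_).mul continuous_const
    · exact N.continuous.comp (by fun_prop)
    · exact Complex.continuous_conj.comp (E.continuous.comp (by fun_prop))
  have ht := (hc.tendsto 0).mono_left (nhdsWithin_le_nhds (s := Set.Ioi 0))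
  simp only [Complex.ofReal_zero, zero_mul, add_zero] at ht
  refine le_of_tendsto ht ?_
  filter_upwards [self_mem_nhdsWithin] with ε hε
  have hε : (0 : ℝ) < ε := hε
  have h := him (ρ + ε * v) (by simp [hρ]; positivity)
  have e : N.eval (ρ + ε * v) * conj (((X - C ρ) ^ k * E).eval (ρ + ε * v)) =
      ((ε ^ k : ℝ) : ℂ) * (N.eval (ρ + ε * v) * conj (E.eval (ρ + ε * v)) * conj v ^ k) := by
    simp only [eval_mul, eval_pow, eval_sub, eval_X, eval_C, map_mul, map_pow, Complex.ofReal_pow,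
      add_sub_cancel_left, Complex.conj_ofReal]
    ring
  rw [e, Complex.im_ofReal_mul] at h
  exact nonpos_of_mul_nonpos_right h (by positivity)

-- For `k ≥ 2` the argument of `v ^ k` covers all of `(0, 2π)`, so `c * conj v ^ k` cannot stay in a
-- half plane unless `c = 0`. This excludes multiple poles.
open ComplexConjugate in
theorem eq_zero_of_im_mul_pow_nonpos {c : ℂ} {k : ℕ} (hk : 2 ≤ k)
    (h : ∀ v : ℂ, 0 < v.im → (c * conj v ^ k).im ≤ 0) : c = 0 := by
  have key : ∀ α : ℝ, 0 < α → α < 2 * Real.pi →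
      c.im * Real.cos α ≤ c.re * Real.sin α := by
    intro α h0 h1
    have hk' : (2 : ℝ) ≤ k := by exact_mod_cast hk
    have := h (Complex.exp ((α / k : ℝ) * Complex.I)) (by
      rw [Complex.exp_ofReal_mul_I_im]
      refine Real.sin_pos_of_pos_of_lt_pi (by positivity) ?_
      rw [div_lt_iff₀ (by positivity)]
      nlinarith [Real.pi_pos])
    rw [← map_pow, ← Complex.exp_nat_mul] at this
    have e : (k : ℂ) * ((α / k : ℝ) * Complex.I) = (α : ℝ) * Complex.I := by
      have : (k : ℂ) ≠ 0 := by
        have : k ≠ 0 := by omega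
        exact_mod_cast this
      push_cast
      field_simp
    rw [e] at this
    simp only [Complex.mul_im, Complex.conj_re, Complex.conj_im, Complex.exp_ofReal_mul_I_im,
      Complex.exp_ofReal_mul_I_re] at this
    linarith
  have hpi := Real.pi_pos
  have h1 := key (Real.pi / 2) (by linarith) (by linarith)
  have h2 := key Real.pi (by linarith) (by linarith)
  have h3 := key (Real.pi / 2 + Real.pi) (by linarith) (by linarith)
  have h4 := key (Real.pi / 4) (by linarith) (by linarith)
  rw [Real.cos_add_pi, Real.sin_add_pi] at h3
  simp only [Real.cos_pi_div_two, Real.sin_pi_div_two, Real.cos_pi, Real.sin_pi] at h1 h2 h3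
  rw [Real.cos_pi_div_four, Real.sin_pi_div_four] at h4
  have hs : 0 < √2 / 2 := by positivity
  have h5 : c.im ≤ c.re := le_of_mul_le_mul_right h4 hs
  apply Complex.ext
  · simp only [Complex.zero_re]; linarith
  · simp only [Complex.zero_im]; linarith

open ComplexConjugate in
theorem nonneg_of_im_mul_nonpos {c : ℂ} (h : ∀ v : ℂ, 0 < v.im → (c * conj v).im ≤ 0) :
    0 ≤ c.re ∧ c.im = 0 := by
  have key : ∀ t : ℝ, c.im * t ≤ c.re := by
    intro t
    have := h ⟨t, 1⟩ one_pos
    simp only [Complex.mul_im, Complex.conj_re, Complex.conj_im] at this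
    linarith
  refine ⟨by simpa using key 0, ?_⟩
  by_contra hne
  have := key ((c.re + 1) / c.im)
  rw [mul_div_cancel₀ _ hne] at this
  linarith

open Polynomial Filter Topology ComplexConjugate in
/-- Partial fractions of a rational function that maps the upper half plane to the closed lower
half plane, is bounded on `[0, ∞)` and has only negative real poles. -/
theorem exists_partial_fractions_of_isCoprime {D N : ℂ[X]} (hND : IsCoprime N D) (hD0 : D ≠ 0)
    (hD : ∀ s, D.eval s = 0 → s.im = 0 ∧ s.re < 0)
    (him : ∀ s : ℂ, 0 < s.im → (N.eval s * conj (D.eval s)).im ≤ 0)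
    (hb : ∃ c : ℝ, ∀ s : ℝ, 0 ≤ s → ‖N.eval (s : ℂ)‖ ≤ c * ‖D.eval (s : ℂ)‖) :
    ∃ (c : ℂ) (R : Finset ℂ) (M : ℂ → ℝ), (∀ ρ ∈ R, ρ.im = 0 ∧ ρ.re < 0 ∧ 0 ≤ M ρ) ∧
      ∀ s, D.eval s ≠ 0 → N.eval s / D.eval s = c + ∑ ρ ∈ R, M ρ / (s - ρ) := by
  have hN : ∀ ρ, D.eval ρ = 0 → N.eval ρ ≠ 0 := by
    intro ρ h0 h1
    obtain ⟨a, b, hab⟩ := hND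
    have := congrArg (eval ρ) hab
    simp [h0, h1] at this
  have hsimple : ∀ ρ, D.eval ρ = 0 → ∃ E : ℂ[X], D = (X - C ρ) * E ∧ E.eval ρ ≠ 0 := by
    intro ρ h0
    obtain ⟨E, hE, hE'⟩ := exists_eq_pow_rootMultiplicity_mul_and_not_dvd D hD0 ρ
    rw [dvd_iff_isRoot, IsRoot.def] at hE'
    have hk : rootMultiplicity ρ D < 2 := by
      by_contra hk
      have := eq_zero_of_im_mul_pow_nonpos (not_lt.1 hk) fun v hv =>
        im_leading_coeff_nonpos (hD ρ h0).1 (fun s hs => by rw [← hE]; exact him s hs) hv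
      rw [mul_eq_zero, map_eq_zero] at this
      exact this.elim (hN ρ h0) hE'
    have hk' : 0 < rootMultiplicity ρ D := (rootMultiplicity_pos hD0).2 h0
    have hk1 : rootMultiplicity ρ D = 1 := by omega
    rw [hk1, pow_one] at hE
    exact ⟨E, hE, hE'⟩
  have hnodup : D.roots.Nodup := by
    rw [Multiset.nodup_iff_count_le_one]
    intro ρ
    rw [count_roots]
    by_contra hk
    have h2 : (X - C ρ) ^ 2 ∣ D := (le_rootMultiplicity_iff hD0).1 (not_le.1 hk)
    have h0 : D.eval ρ = 0 := by
      obtain ⟨q, hq⟩ := h2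
      rw [hq]; simp
    obtain ⟨E, hE, hE'⟩ := hsimple ρ h0
    rw [hE, pow_two] at h2
    have := (mul_dvd_mul_iff_left (X_sub_C_ne_zero ρ)).1 h2
    rw [dvd_iff_isRoot] at this
    exact hE' this
  set R := D.roots.toFinset with hR
  have hmem : ∀ ρ, ρ ∈ R ↔ D.eval ρ = 0 := by
    intro ρ
    rw [hR, Multiset.mem_toFinset, mem_roots hD0, IsRoot.def]
  have hDn : D = C D.leadingCoeff * Lagrange.nodal R id := by
    conv_lhs => rw [(IsAlgClosed.splits D).eq_prod_roots]
    rw [Lagrange.nodal_eq, Finset.prod, hR, Multiset.toFinset_val, hnodup.dedup]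
    rfl
  have hl : D.leadingCoeff ≠ 0 := leadingCoeff_ne_zero.2 hD0
  have hdeg : (N % D).degree < R.card := by
    have h1 : D.degree = R.card := by
      conv_lhs => rw [hDn, degree_C_mul hl, Lagrange.degree_nodal]
    rw [← h1]
    exact degree_mod_lt N hD0
  have hint := Lagrange.eq_interpolate (s := R) (v := (id : ℂ → ℂ)) (Set.injOn_id _) hdeg
  have hdiv : D * (N / D) + N % D = N := EuclideanDomain.div_add_mod N D
  -- The residue of `N / D` at `ρ`, because the derivative of `D` at `ρ` is the leading coefficient
  -- divided by the nodal weight.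
  let m : ℂ → ℂ := fun ρ => Lagrange.nodalWeight R id ρ * N.eval ρ / D.leadingCoeff
  have hm : ∀ ρ ∈ R, 0 ≤ (m ρ).re ∧ (m ρ).im = 0 := by
    intro ρ hρ
    have h0 := (hmem ρ).1 hρ
    obtain ⟨E, hE, hE'⟩ := hsimple ρ h0
    have hn := nonneg_of_im_mul_nonpos (c := N.eval ρ * conj (E.eval ρ)) fun v hv => by
      have := im_leading_coeff_nonpos (N := N) (E := E) (k := 1) (hD ρ h0).1
        (fun s hs => by rw [pow_one, ← hE]; exact him s hs) hv
      rwa [pow_one] at this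
    have hder : E.eval ρ = D.leadingCoeff * (Lagrange.nodalWeight R id ρ)⁻¹ := by
      rw [Lagrange.nodalWeight_eq_eval_derivative_nodal hρ, inv_inv]
      have h1 : eval ρ (derivative D) = E.eval ρ := by rw [hE]; simp
      rw [← h1]
      conv_lhs => rw [hDn]
      simp
    have hw : Lagrange.nodalWeight R id ρ ≠ 0 :=
      Lagrange.nodalWeight_ne_zero (Set.injOn_id _) hρ
    have hmE : m ρ = ((‖E.eval ρ‖ ^ 2)⁻¹ : ℝ) * (N.eval ρ * conj (E.eval ρ)) := by
      have h1 : m ρ = N.eval ρ / E.eval ρ := by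
        rw [hder]; simp only [m]; field_simp
      rw [h1, div_eq_mul_inv, Complex.inv_def, Complex.normSq_eq_norm_sq]
      ring
    rw [hmE, Complex.re_ofReal_mul, Complex.im_ofReal_mul, hn.2]
    exact ⟨mul_nonneg (by positivity) hn.1, mul_zero _⟩
  have hform : ∀ s, D.eval s ≠ 0 →
      N.eval s / D.eval s = (N / D).eval s + ∑ ρ ∈ R, ((m ρ).re : ℂ) / (s - ρ) := by
    intro s hs
    have h1 : (N % D).eval s =
        D.eval s * ∑ ρ ∈ R, ((m ρ).re : ℂ) / (s - ρ) := by
      conv_lhs => rw [hint]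
      rw [Lagrange.eval_interpolate_not_at_node]
      · have hD' : D.eval s = D.leadingCoeff * (Lagrange.nodal R id).eval s := by
          conv_lhs => rw [hDn]
          simp
        rw [hD', mul_comm D.leadingCoeff, mul_assoc, Finset.mul_sum _ _ D.leadingCoeff]
        congr 1
        refine Finset.sum_congr rfl fun ρ hρ => ?_
        have hre : ((m ρ).re : ℂ) = m ρ := Complex.ext (by simp) (by simp [(hm ρ hρ).2])
        have hr : (N % D).eval (id ρ) = N.eval ρ := by
          conv_rhs => rw [← hdiv]
          simp [(hmem ρ).1 hρ]
        rw [hre, hr]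
        simp only [m, id]
        field_simp
      · intro ρ hρ h
        rw [h] at hs
        exact hs ((hmem ρ).1 hρ)
    have h2 : N.eval s = D.eval s * (N / D).eval s + (N % D).eval s := by
      conv_lhs => rw [← hdiv]
      simp
    rw [h2, h1]
    field_simp
  -- A nonconstant polynomial part would be unbounded on `[0, ∞)`, where `N / D` and all the
  -- fractions are bounded.
  have hconst : (N / D).degree ≤ 0 := by
    by_contra hlt
    have hlt := not_le.1 hlt
    obtain ⟨c, hc⟩ := hb
    have ht := tendsto_norm_atTop (N / D) hlt (l := atTop) (z := fun x : ℝ => (x : ℂ)) (by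
      simpa using tendsto_abs_atTop_atTop)
    obtain ⟨s, hs1, hs2⟩ := ((ht.eventually_gt_atTop
      (c + ∑ ρ ∈ R, |(m ρ).re| / |ρ.re|)).and (eventually_ge_atTop 0)).exists
    have hDs : D.eval (s : ℂ) ≠ 0 := by
      intro h
      have := (hD _ h).2
      simp at this
      linarith
    have h3 : (N / D).eval (s : ℂ) =
        N.eval (s : ℂ) / D.eval (s : ℂ) - ∑ ρ ∈ R, ((m ρ).re : ℂ) / (s - ρ) := by
      rw [hform s hDs]; ring
    rw [h3] at hs1
    refine absurd hs1 (not_lt.2 ((norm_sub_le _ _).trans (add_le_add ?_ ?_)))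
    · rw [norm_div, div_le_iff₀ (norm_pos_iff.2 hDs)]
      exact hc s hs2
    · refine (norm_sum_le _ _).trans (Finset.sum_le_sum fun ρ hρ => ?_)
      have h0 := hD ρ ((hmem ρ).1 hρ)
      rw [norm_div, Complex.norm_real, Real.norm_eq_abs]
      refine div_le_div_of_nonneg_left (abs_nonneg _) (abs_pos.2 h0.2.ne) ?_
      refine le_trans ?_ (Complex.abs_re_le_norm _)
      rw [Complex.sub_re, Complex.ofReal_re, abs_of_neg h0.2, abs_of_pos (by linarith)]
      linarith
  refine ⟨(N / D).coeff 0, R, fun ρ => (m ρ).re, fun ρ hρ => ?_, fun s hs => ?_⟩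
  · have h0 := hD ρ ((hmem ρ).1 hρ)
    exact ⟨h0.1, h0.2, (hm ρ hρ).1⟩
  · rw [hform s hs]
    congr 1
    conv_lhs => rw [eq_C_of_degree_le_zero hconst]
    simp

-- Cancelling the gcd `G` divides `N * conj D` by `‖G‖ ^ 2`, which preserves the sign of the
-- imaginary part. Zeros of `G` are zeros of `D`, so there are none in the upper half plane or on
-- `[0, ∞)`.
open Polynomial Filter Topology ComplexConjugate in
theorem exists_partial_fractions {D N : ℂ[X]} (hD0 : D ≠ 0)
    (hD : ∀ s, D.eval s = 0 → s.im = 0 ∧ s.re < 0)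
    (him : ∀ s : ℂ, 0 < s.im → (N.eval s * conj (D.eval s)).im ≤ 0)
    (hb : ∃ c : ℝ, ∀ s : ℝ, 0 ≤ s → ‖N.eval (s : ℂ)‖ ≤ c * ‖D.eval (s : ℂ)‖) :
    ∃ (c : ℂ) (R : Finset ℂ) (M : ℂ → ℝ), (∀ ρ ∈ R, ρ.im = 0 ∧ ρ.re < 0 ∧ 0 ≤ M ρ) ∧
      ∀ s, D.eval s ≠ 0 → N.eval s / D.eval s = c + ∑ ρ ∈ R, M ρ / (s - ρ) := by
  classical
  let _ := EuclideanDomain.gcdMonoid ℂ[X]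
  obtain ⟨N', hN'⟩ := gcd_dvd_left N D
  obtain ⟨D', hD'⟩ := gcd_dvd_right N D
  have hcop : IsCoprime N' D' := by
    have hg : gcd N D ≠ 0 := fun h => hD0 (by rw [hD', h, zero_mul])
    have := isCoprime_div_gcd_div_gcd (p := N) hD0
    rwa [EuclideanDomain.div_eq_iff_eq_mul_of_dvd _ _ _ hg (gcd_dvd_left N D) |>.2 hN',
      EuclideanDomain.div_eq_iff_eq_mul_of_dvd _ _ _ hg (gcd_dvd_right N D) |>.2 hD'] at this
  set G := gcd N D
  have hG : ∀ s, D.eval s ≠ 0 → G.eval s ≠ 0 := by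
    intro s hs h
    rw [hD', eval_mul, h, zero_mul] at hs
    exact hs rfl
  have hDs : ∀ s : ℂ, 0 < s.im → D.eval s ≠ 0 := fun s hs h => by
    have := (hD s h).1
    linarith
  obtain ⟨c, R, M, hM, hf⟩ := exists_partial_fractions_of_isCoprime hcop
    (fun h => hD0 (by rw [hD', h, mul_zero]))
    (fun s hs => hD s (by rw [hD', eval_mul, hs, mul_zero]))
    (fun s hs => by
      have h := him s hs
      have h0 := hG s (hDs s hs)
      have e : N.eval s * conj (D.eval s) =
          ((‖G.eval s‖ ^ 2 : ℝ) : ℂ) * (N'.eval s * conj (D'.eval s)) := by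
        rw [hN', hD', eval_mul, eval_mul, map_mul, Complex.ofReal_pow, ← Complex.mul_conj']
        ring
      rw [e, Complex.im_ofReal_mul] at h
      exact nonpos_of_mul_nonpos_right h (by positivity))
    (by
      obtain ⟨c, hc⟩ := hb
      refine ⟨c, fun s hs => ?_⟩
      have h := hc s hs
      have h0 : G.eval (s : ℂ) ≠ 0 := hG s fun h => by
        have := (hD _ h).2
        simp at this
        linarith
      rw [hN', hD', eval_mul, eval_mul, norm_mul, norm_mul, mul_left_comm] at h
      exact le_of_mul_le_mul_left h (norm_pos_iff.2 h0))
  refine ⟨c, R, M, hM, fun s hs => ?_⟩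
  have h0 := hG s hs
  rw [← hf s fun h => hs (by rw [hD', eval_mul, h, mul_zero])]
  rw [hN', hD', eval_mul, eval_mul, mul_div_mul_left _ _ h0]

open Polynomial Filter Topology ComplexConjugate in
/-- The graph of `N / D` on `[0, ∞)` lies above its tangents. -/
theorem tangent_le_of_im_nonpos {D N : ℂ[X]} (hD0 : D ≠ 0)
    (hD : ∀ s, D.eval s = 0 → s.im = 0 ∧ s.re < 0)
    (him : ∀ s : ℂ, 0 < s.im → (N.eval s * conj (D.eval s)).im ≤ 0)
    (hb : ∃ c : ℝ, ∀ s : ℝ, 0 ≤ s → ‖N.eval (s : ℂ)‖ ≤ c * ‖D.eval (s : ℂ)‖)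
    {δ : ℝ} (hδ : 0 ≤ δ) :
    (N.eval (δ : ℂ) / D.eval (δ : ℂ) + δ * ((N.eval (δ : ℂ) * D.derivative.eval (δ : ℂ) -
      N.derivative.eval (δ : ℂ) * D.eval (δ : ℂ)) / D.eval (δ : ℂ) ^ 2)).re ≤
      (N.eval 0 / D.eval 0).re := by
  obtain ⟨c, R, M, hM, hf⟩ := exists_partial_fractions hD0 hD him hb
  have hDs : ∀ s : ℝ, 0 ≤ s → D.eval (s : ℂ) ≠ 0 := fun s hs h => by
    have := (hD _ h).2
    simp at this
    linarith
  have hne : ∀ s : ℝ, 0 ≤ s → ∀ ρ ∈ R, (s : ℂ) - ρ ≠ 0 := fun s hs ρ hρ h => by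
    have := (hM ρ hρ).2.1
    have := congrArg Complex.re h
    simp at this
    linarith
  have hd1 : HasDerivAt (fun s => N.eval s / D.eval s)
      ((N.derivative.eval (δ : ℂ) * D.eval (δ : ℂ) - N.eval (δ : ℂ) * D.derivative.eval (δ : ℂ)) /
        D.eval (δ : ℂ) ^ 2) δ := (N.hasDerivAt _).div (D.hasDerivAt _) (hDs δ hδ)
  have hd2 : HasDerivAt (fun s => c + ∑ ρ ∈ R, (M ρ : ℂ) / (s - ρ))
      (∑ ρ ∈ R, (0 * ((δ : ℂ) - ρ) - M ρ * 1) / ((δ : ℂ) - ρ) ^ 2) δ := by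
    refine HasDerivAt.const_add c (HasDerivAt.fun_sum fun ρ hρ => ?_)
    exact (hasDerivAt_const _ _).div ((hasDerivAt_id' _).sub_const _) (hne δ hδ ρ hρ)
  have hev : (fun s => N.eval s / D.eval s) =ᶠ[𝓝 (δ : ℂ)]
      fun s => c + ∑ ρ ∈ R, (M ρ : ℂ) / (s - ρ) := by
    filter_upwards [D.continuous.continuousAt.eventually_ne (hDs δ hδ)] with s hs using hf s hs
  have hd := hd1.unique (hd2.congr_of_eventuallyEq hev)
  have e : (N.eval (δ : ℂ) * D.derivative.eval (δ : ℂ) -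
      N.derivative.eval (δ : ℂ) * D.eval (δ : ℂ)) / D.eval (δ : ℂ) ^ 2 =
      ∑ ρ ∈ R, (M ρ : ℂ) / ((δ : ℂ) - ρ) ^ 2 := by
    rw [← neg_sub (N.derivative.eval (δ : ℂ) * D.eval (δ : ℂ)), neg_div, hd,
      ← Finset.sum_neg_distrib]
    refine Finset.sum_congr rfl fun ρ _ => ?_
    ring
  have h0 := hf 0 (by simpa using hDs 0 le_rfl)
  rw [e, hf δ (hDs δ hδ), h0, add_assoc, Complex.add_re c, Complex.add_re c, Finset.mul_sum,
    ← Finset.sum_add_distrib, Complex.re_sum, Complex.re_sum]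
  refine add_le_add_right (Finset.sum_le_sum fun ρ hρ => ?_) _
  obtain ⟨h1, h2, h3⟩ := hM ρ hρ
  have hρ' : ρ = (ρ.re : ℂ) := Complex.ext rfl (by simp [h1])
  have e1 : (M ρ : ℂ) / (δ - ρ) + δ * (M ρ / (δ - ρ) ^ 2) =
      ((M ρ / (δ - ρ.re) + δ * (M ρ / (δ - ρ.re) ^ 2) : ℝ) : ℂ) := by
    rw [hρ']; push_cast; simp
  have e2 : (M ρ : ℂ) / (0 - ρ) = ((M ρ / (0 - ρ.re) : ℝ) : ℂ) := by
    rw [hρ']; push_cast; simp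
  rw [e1, e2, Complex.ofReal_re, Complex.ofReal_re]
  have hp : 0 < δ - ρ.re := by linarith
  have hq : 0 < 0 - ρ.re := by linarith
  -- Convexity of a single fraction, with the gap to its tangent made explicit.
  have : M ρ / (0 - ρ.re) - (M ρ / (δ - ρ.re) + δ * (M ρ / (δ - ρ.re) ^ 2)) =
      M ρ * δ ^ 2 / ((0 - ρ.re) * (δ - ρ.re) ^ 2) := by
    field_simp
    ring
  have h4 : 0 ≤ M ρ * δ ^ 2 / ((0 - ρ.re) * (δ - ρ.re) ^ 2) := by positivity
  linarith

/-! ### Multiaffine real stable functions -/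

/-- The difference `f (z + e_a) - f z`: for `f` affine in each coordinate, the partial derivative. -/
def pdiff {ι : Type*} [DecidableEq ι] (a : ι) (f : (ι → ℂ) → ℂ) (z : ι → ℂ) : ℂ :=
  f (z + Pi.single a 1) - f z

/-- Functions on `ℂ^ι` that are affine in each coordinate. -/
def IsMultiaffine {ι : Type*} [DecidableEq ι] (f : (ι → ℂ) → ℂ) : Prop :=
  ∀ z a t, f (z + Pi.single a t) = f z + t * pdiff a f z

/-- The point of `ℂ^ι` with the given real coordinates. -/
def realPt {ι : Type*} (x : ι → ℝ) : ι → ℂ := fun a => (x a : ℂ)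

/-- The restriction of `f` to real points. -/
def rval {ι : Type*} (f : (ι → ℂ) → ℂ) (x : ι → ℝ) : ℝ := (f (realPt x)).re

open ComplexConjugate in
/-- Multiaffine real stable functions. -/
structure IsRealStable {ι : Type*} [DecidableEq ι] (f : (ι → ℂ) → ℂ) : Prop where
  affine : IsMultiaffine f
  cont : Continuous f
  conj_apply : ∀ z, f (fun a => conj (z a)) = conj (f z)
  ne_zero : ∀ z, (∀ a, 0 < (z a).im) → f z ≠ 0

/-- The operator `1 - ∑ k ∈ K, ∂_k`. -/
def diffOp {ι : Type*} [DecidableEq ι] (K : Finset ι) (f : (ι → ℂ) → ℂ) (z : ι → ℂ) : ℂ :=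
  f z - ∑ k ∈ K, pdiff k f z

section

variable {ι : Type*} {f : (ι → ℂ) → ℂ}

open ComplexConjugate

theorem realPt_add (x y : ι → ℝ) : realPt (x + y) = realPt x + realPt y := by
  funext a; simp [realPt]

theorem im_realPt_eq_zero (hf : ∀ z, f (fun a => conj (z a)) = conj (f z)) (x : ι → ℝ) :
    (f (realPt x)).im = 0 := by
  have h := hf (realPt x)
  have e : (fun a => conj (realPt x a)) = realPt x := by
    funext a; simp [realPt]
  rw [e] at h
  exact Complex.conj_eq_iff_im.1 h.symm

theorem apply_realPt (hf : ∀ z, f (fun a => conj (z a)) = conj (f z)) (x : ι → ℝ) :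
    f (realPt x) = (rval f x : ℂ) :=
  Complex.ext rfl (by simp [im_realPt_eq_zero hf])

variable [DecidableEq ι]

theorem IsMultiaffine.pdiff (hf : IsMultiaffine f) (b : ι) : IsMultiaffine (pdiff b f) := by
  intro z a t
  have h1 := hf (z + Pi.single b 1) a t
  have h2 := hf z a t
  simp only [_root_.pdiff] at h1 h2 ⊢
  rw [add_right_comm, h1, h2, add_right_comm z (Pi.single a 1)]
  ring

theorem IsMultiaffine.pdiff_add_single (hf : IsMultiaffine f) (z : ι → ℂ) (a : ι) (t : ℂ) :
    _root_.pdiff a f (z + Pi.single a t) = _root_.pdiff a f z := by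
  rw [_root_.pdiff, add_assoc, ← Pi.single_add, hf, hf]
  ring

theorem pdiff_comm (a b : ι) (f : (ι → ℂ) → ℂ) : pdiff a (pdiff b f) = pdiff b (pdiff a f) := by
  funext z
  simp only [pdiff]
  rw [add_right_comm]
  ring

theorem realPt_single (a : ι) (t : ℝ) : realPt (Pi.single a t) = Pi.single a (t : ℂ) := by
  funext b
  by_cases h : b = a
  · subst h; simp [realPt]
  · simp [realPt, h]

theorem rval_add_single (hf : IsMultiaffine f) (x : ι → ℝ) (a : ι) (t : ℝ) :
    rval f (x + Pi.single a t) = rval f x + t * rval (pdiff a f) x := by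
  rw [rval, realPt_add, realPt_single, hf, Complex.add_re, Complex.re_ofReal_mul]
  rfl

theorem rval_pdiff_add_single (hf : IsMultiaffine f) (x : ι → ℝ) (a : ι) (t : ℝ) :
    rval (pdiff a f) (x + Pi.single a t) = rval (pdiff a f) x := by
  rw [rval, realPt_add, realPt_single, hf.pdiff_add_single]
  rfl

theorem rval_diffOp (K : Finset ι) (f : (ι → ℂ) → ℂ) (x : ι → ℝ) :
    rval (diffOp K f) x = rval f x - ∑ k ∈ K, rval (pdiff k f) x := by
  simp [rval, diffOp]

theorem pdiff_diffOp (K : Finset ι) (f : (ι → ℂ) → ℂ) (a : ι) :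
    pdiff a (diffOp K f) = diffOp K (pdiff a f) := by
  funext z
  have : ∀ k, pdiff k (pdiff a f) z = pdiff k f (z + Pi.single a 1) - pdiff k f z := fun k => by
    rw [pdiff_comm]; rfl
  simp only [diffOp, this, Finset.sum_sub_distrib]
  simp only [pdiff, diffOp, Finset.sum_sub_distrib]
  ring

theorem IsMultiaffine.diffOp (hf : IsMultiaffine f) (K : Finset ι) :
    IsMultiaffine (diffOp K f) := by
  intro z a t
  rw [pdiff_diffOp, _root_.diffOp, _root_.diffOp, _root_.diffOp, hf z a t]
  have : ∀ k, _root_.pdiff k f (z + Pi.single a t) =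
      _root_.pdiff k f z + t * _root_.pdiff k (_root_.pdiff a f) z := fun k => by
    rw [hf.pdiff k z a t, pdiff_comm]
  simp only [this, Finset.sum_add_distrib, ← Finset.mul_sum]
  ring

theorem continuous_pdiff (hf : Continuous f) (a : ι) : Continuous (pdiff a f) :=
  (hf.comp (continuous_id.add continuous_const)).sub hf

theorem pdiff_conj (hf : ∀ z, f (fun a => conj (z a)) = conj (f z)) (a : ι) (z : ι → ℂ) :
    pdiff a f (fun b => conj (z b)) = conj (pdiff a f z) := by
  rw [pdiff, pdiff, map_sub, ← hf, ← hf]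
  congr 2
  funext b
  by_cases h : b = a
  · subst h; simp
  · simp [h]

/-- Otherwise moving coordinate `a` by `-f / ∂_a f` keeps it in the upper half plane and reaches a
zero of the affine function. -/
theorem IsRealStable.im_pdiff_div_neg (hf : IsRealStable f) {z : ι → ℂ} (hz : ∀ a, 0 < (z a).im)
    {a : ι} (h : pdiff a f z ≠ 0) : (pdiff a f z / f z).im < 0 := by
  by_contra hneg
  have hneg := not_lt.1 hneg
  have h0 := hf.ne_zero z hz
  refine hf.ne_zero (z + Pi.single a (-(pdiff a f z / f z)⁻¹)) (fun b => ?_) ?_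
  · by_cases hb : b = a
    · subst hb
      have : 0 ≤ (-(pdiff b f z / f z)⁻¹).im := by
        rw [Complex.neg_im, Complex.inv_im, neg_div, neg_neg]
        exact div_nonneg hneg (Complex.normSq_nonneg _)
      simpa using add_pos_of_pos_of_nonneg (hz b) this
    · simpa [hb] using hz b
  · rw [hf.affine]
    field_simp
    ring

theorem im_div_eq (p q : ℂ) : (p * conj q).im = ‖q‖ ^ 2 * (p / q).im := by
  by_cases hq : q = 0
  · simp [hq]
  · have : p * conj q = ((‖q‖ ^ 2 : ℝ) : ℂ) * (p / q) := by
      rw [Complex.ofReal_pow, ← Complex.mul_conj']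
      field_simp
    rw [this, Complex.im_ofReal_mul]

/-- A limit from the open half plane; unlike the quotient, the product with the conjugate is
continuous where `f` vanishes. -/
theorem IsRealStable.im_pdiff_mul_conj_nonpos (hf : IsRealStable f) {z : ι → ℂ}
    (hz : ∀ a, 0 ≤ (z a).im) (a : ι) : (pdiff a f z * conj (f z)).im ≤ 0 := by
  let y : ℝ → ι → ℂ := fun ε b => z b + ε * Complex.I
  have hy : Continuous y := by fun_prop
  have hc : Continuous fun ε => (pdiff a f (y ε) * conj (f (y ε))).im :=
    Complex.continuous_im.comp (((continuous_pdiff hf.cont a).comp hy).mul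
      (Complex.continuous_conj.comp (hf.cont.comp hy)))
  have ht := (hc.tendsto 0).mono_left (nhdsWithin_le_nhds (s := Set.Ioi 0))
  have hy0 : y 0 = z := by funext b; simp [y]
  rw [hy0] at ht
  refine le_of_tendsto ht ?_
  filter_upwards [self_mem_nhdsWithin] with ε hε
  have hε : (0 : ℝ) < ε := hε
  have hyε : ∀ b, 0 < (y ε b).im := fun b => by
    simpa [y] using add_pos_of_nonneg_of_pos (hz b) hε
  by_cases h : pdiff a f (y ε) = 0
  · simp [h]
  · rw [im_div_eq]
    exact mul_nonpos_of_nonneg_of_nonpos (by positivity) (hf.im_pdiff_div_neg hyε h).le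

/-- The Rayleigh inequality. -/
theorem IsRealStable.rayleigh (hf : IsRealStable f) (x : ι → ℝ) (a b : ι) :
    rval f x * rval (pdiff a (pdiff b f)) x ≤ rval (pdiff a f) x * rval (pdiff b f) x := by
  -- Expanding `f` and `∂_a f` at `x + i e_b` makes this imaginary part equal to `f ∂_a∂_b f - ∂_a f
  -- ∂_b f` at `x`.
  have h := hf.im_pdiff_mul_conj_nonpos (z := realPt x + Pi.single b Complex.I) (fun c => by
    by_cases hc : c = b
    · subst hc; simp [realPt]
    · simp [realPt, hc]) a
  have hca := pdiff_conj hf.conj_apply a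
  have hcb := pdiff_conj hf.conj_apply b
  rw [hf.affine, hf.affine.pdiff a, apply_realPt hf.conj_apply, apply_realPt hca,
    apply_realPt hcb, pdiff_comm, apply_realPt (pdiff_conj hcb a)] at h
  simp at h
  linarith

/-- At a zero the ratios `∂_k f / f` would sum to `1`. Each of them has negative imaginary part or
vanishes, so all would vanish. -/
theorem IsRealStable.diffOp (hf : IsRealStable f) (K : Finset ι) :
    IsRealStable (diffOp K f) where
  affine := hf.affine.diffOp K
  cont := hf.cont.sub (continuous_finsetSum _ fun k _ => continuous_pdiff hf.cont k)
  conj_apply z := by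
    simp only [_root_.diffOp, map_sub, map_sum, hf.conj_apply, pdiff_conj hf.conj_apply]
  ne_zero z hz h := by
    have h0 := hf.ne_zero z hz
    have h1 : ∑ k ∈ K, pdiff k f z / f z = 1 := by
      rw [← Finset.sum_div, div_eq_one_iff_eq h0]
      exact (sub_eq_zero.1 h).symm
    have hle : ∀ k ∈ K, (pdiff k f z / f z).im ≤ 0 := fun k _ => by
      by_cases hk : pdiff k f z = 0
      · simp [hk]
      · exact (hf.im_pdiff_div_neg hz hk).le
    have h2 : ∑ k ∈ K, (pdiff k f z / f z).im = 0 := by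
      rw [← Complex.im_sum, h1, Complex.one_im]
    rw [Finset.sum_eq_zero_iff_of_nonpos hle] at h2
    rw [Finset.sum_eq_zero] at h1
    · exact zero_ne_one h1
    · intro k hk
      by_cases hk' : pdiff k f z = 0
      · simp [hk']
      · exact absurd (h2 k hk) (hf.im_pdiff_div_neg hz hk').ne

theorem IsRealStable.comp_add (hf : IsRealStable f) (v : ι → ℝ) :
    IsRealStable fun z => f (z + realPt v) where
  affine z a t := by
    simp only [pdiff]
    rw [add_right_comm, hf.affine, add_right_comm z]
    rfl
  cont := hf.cont.comp (continuous_id.add continuous_const)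
  conj_apply z := by
    rw [← hf.conj_apply]
    congr 1
    funext a
    simp [realPt]
  ne_zero z hz := hf.ne_zero _ fun a => by simpa [realPt] using hz a

/-- The modulus of a real stable function grows with the imaginary parts of the coordinates. -/
theorem IsRealStable.norm_le_norm_add_single (hf : IsRealStable f) {z : ι → ℂ}
    (hz : ∀ a, 0 ≤ (z a).im) (a : ι) {t : ℝ} (ht : 0 ≤ t) :
    ‖f z‖ ≤ ‖f (z + Pi.single a (t * Complex.I))‖ := by
  have h := hf.im_pdiff_mul_conj_nonpos hz a
  rw [hf.affine]
  refine (sq_le_sq₀ (norm_nonneg _) (norm_nonneg _)).1 ?_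
  rw [← Complex.normSq_eq_norm_sq, ← Complex.normSq_eq_norm_sq, Complex.normSq_apply,
    Complex.normSq_apply]
  simp only [Complex.mul_im, Complex.conj_re, Complex.conj_im, Complex.add_re, Complex.add_im,
    Complex.mul_re, Complex.ofReal_re, Complex.ofReal_im, Complex.I_re, Complex.I_im] at h ⊢
  nlinarith [mul_nonneg ht (neg_nonneg.2 h), sq_nonneg (t * (pdiff a f z).re),
    sq_nonneg (t * (pdiff a f z).im)]

/-- The point with coordinates `t` on `S` and `0` elsewhere. -/
def ind {α : Type*} [Zero α] (S : Finset ι) (t : α) : ι → α := fun a => if a ∈ S then t else 0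

theorem ind_empty {α : Type*} [Zero α] (t : α) : ind (∅ : Finset ι) t = 0 := by
  funext a; simp [ind]

theorem ind_insert {α : Type*} [AddZeroClass α] {S : Finset ι} {k : ι} (hk : k ∉ S) (t : α) :
    ind (insert k S) t = ind S t + Pi.single k t := by
  funext a
  by_cases h : a = k
  · subst h; simp [ind, hk]
  · simp [ind, h]

theorem realPt_ind (S : Finset ι) (t : ℝ) : realPt (ind S t) = ind S (t : ℂ) := by
  funext a
  simp only [realPt, ind]
  split_ifs <;> simp

theorem IsRealStable.norm_le_norm_add_ind (hf : IsRealStable f) {z : ι → ℂ}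
    (hz : ∀ a, 0 ≤ (z a).im) (S : Finset ι) {t : ℝ} (ht : 0 ≤ t) :
    ‖f z‖ ≤ ‖f (z + ind S (t * Complex.I))‖ := by
  induction S using Finset.induction_on with
  | empty => simp [ind_empty]
  | insert k S hk ih =>
    rw [ind_insert hk, ← add_assoc]
    refine ih.trans (hf.norm_le_norm_add_single (fun a => ?_) k ht)
    have : 0 ≤ (ind S ((t : ℂ) * Complex.I) a).im := by
      simp only [ind]; split_ifs <;> simp [ht]
    simpa using add_nonneg (hz a) this

open Polynomial in
/-- Along the direction of a coordinate set, a multiaffine function is a polynomial. -/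
theorem IsMultiaffine.exists_polynomial (hf : IsMultiaffine f) (S : Finset ι) (w : ι → ℂ) :
    ∃ q : ℂ[X], ∀ s, q.eval s = f (w + ind S s) ∧
      q.derivative.eval s = ∑ k ∈ S, _root_.pdiff k f (w + ind S s) := by
  induction S using Finset.induction_on generalizing w with
  | empty => exact ⟨C (f w), fun s => by simp [ind_empty]⟩
  | insert k S hk ih =>
    obtain ⟨q₁, h₁⟩ := ih w
    obtain ⟨q₂, h₂⟩ := ih (w + Pi.single k 1)
    refine ⟨q₁ + X * (q₂ - q₁), fun s => ⟨?_, ?_⟩⟩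
    · rw [eval_add, eval_mul, eval_sub, eval_X, (h₁ s).1, (h₂ s).1, ind_insert hk, ← add_assoc, hf,
        _root_.pdiff, add_right_comm w]
    · rw [derivative_add, derivative_mul, derivative_sub, derivative_X]
      simp only [eval_add, eval_mul, eval_sub, eval_X, eval_one, (h₁ s).1, (h₂ s).1, (h₁ s).2,
        (h₂ s).2, ind_insert hk, Finset.sum_insert hk]
      simp only [← add_assoc]
      rw [hf.pdiff_add_single]
      have : ∀ l, _root_.pdiff l f (w + ind S s + Pi.single k s) = _root_.pdiff l f (w + ind S s) +
          s * (_root_.pdiff l f (w + Pi.single k 1 + ind S s) - _root_.pdiff l f (w + ind S s)) :=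
        fun l => by
          rw [hf.pdiff l, add_right_comm w (Pi.single k 1)]; rfl
      simp only [this, Finset.sum_add_distrib, ← Finset.mul_sum, Finset.sum_sub_distrib]
      rw [_root_.pdiff, add_right_comm w]
      ring

end

/-! ### Positivity on orthants and the barrier method -/

/-- `f` is positive on the orthant with corner `w`. -/
def IsAbove {ι : Type*} (f : (ι → ℂ) → ℂ) (w : ι → ℝ) : Prop := ∀ y, w ≤ y → 0 < rval f y

theorem IsAbove.mono {ι : Type*} {f : (ι → ℂ) → ℂ} {w w' : ι → ℝ} (h : IsAbove f w)
    (hw : w ≤ w') : IsAbove f w' := fun y hy => h y (hw.trans hy)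

theorem rval_comp_add {ι : Type*} {f : (ι → ℂ) → ℂ} (v x : ι → ℝ) :
    rval (fun z => f (z + realPt v)) x = rval f (x + v) := by
  rw [rval, rval, realPt_add]

section

variable {ι : Type*} [DecidableEq ι] {f : (ι → ℂ) → ℂ} {w : ι → ℝ}

theorem le_add_single (x : ι → ℝ) (a : ι) {t : ℝ} (ht : 0 ≤ t) : x ≤ x + Pi.single a t :=
  le_add_of_nonneg_right (Pi.single_nonneg.2 ht)

theorem ind_nonneg (S : Finset ι) {t : ℝ} (ht : 0 ≤ t) : 0 ≤ ind S t := fun a => by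
  simp only [ind, Pi.zero_apply]; split_ifs <;> simp [ht]

/-- A path from `x` to `y ≥ x` that raises one coordinate at a time. -/
theorem of_single_steps [Fintype ι] {p : (ι → ℝ) → Prop} {x y : ι → ℝ} (hxy : x ≤ y) (h0 : p x)
    (hstep : ∀ z a t, x ≤ z → 0 ≤ t → p z → p (z + Pi.single a t)) : p y := by
  have key : ∀ S : Finset ι, p (fun a => if a ∈ S then y a else x a) := by
    intro S
    induction S using Finset.induction_on with
    | empty => simpa using h0
    | insert k S hk ih =>
      have := hstep _ k (y k - x k) (fun a => ?_) (sub_nonneg.2 (hxy k)) ih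
      · convert this using 1
        funext a
        by_cases h : a = k
        · subst h; simp [hk]
        · simp [h]
      · dsimp only
        split_ifs
        · exact hxy a
        · exact le_rfl
  simpa using key Finset.univ

/-- With a negative slope the affine function of coordinate `a` would reach zero inside the orthant.
-/
theorem IsAbove.rval_pdiff_nonneg (hf : IsMultiaffine f) (h : IsAbove f w) (a : ι) {y : ι → ℝ}
    (hy : w ≤ y) : 0 ≤ rval (pdiff a f) y := by
  by_contra hneg
  have hneg := not_le.1 hneg
  have h0 := h y hy
  have ht : 0 ≤ rval f y / -rval (pdiff a f) y := div_nonneg h0.le (by linarith)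
  have h1 := h _ (hy.trans (le_add_single y a ht))
  rw [rval_add_single hf, div_neg, neg_mul, div_mul_cancel₀ _ hneg.ne] at h1
  linarith

/-- The Rayleigh inequality says that the ratio decreases in each coordinate separately. -/
theorem IsAbove.ratio_le [Fintype ι] (hf : IsRealStable f) (h : IsAbove f w) (a : ι)
    {x y : ι → ℝ} (hx : w ≤ x) (hxy : x ≤ y) :
    rval (pdiff a f) y / rval f y ≤ rval (pdiff a f) x / rval f x := by
  refine of_single_steps (p := fun y => rval (pdiff a f) y / rval f y ≤
    rval (pdiff a f) x / rval f x) hxy le_rfl fun z b t hz ht ih => le_trans ?_ ih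
  have h0 := h z (hx.trans hz)
  have h1 := h _ ((hx.trans hz).trans (le_add_single z b ht))
  rw [div_le_div_iff₀ h1 h0, rval_add_single hf.affine, rval_add_single (hf.affine.pdiff a)]
  have hR := mul_le_mul_of_nonneg_left (hf.rayleigh z b a) ht
  linarith

open Polynomial ComplexConjugate in
/-- The ratio `∂_j f / f` lies above its tangents in the direction of a set of coordinates. -/
theorem IsAbove.tangent_le [Fintype ι] (hf : IsRealStable f) (h : IsAbove f w) (S : Finset ι)
    (j : ι) {δ : ℝ} (hδ : 0 ≤ δ) :
    rval (pdiff j f) (w + ind S δ) / rval f (w + ind S δ) +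
      δ * ((rval (pdiff j f) (w + ind S δ) * ∑ k ∈ S, rval (pdiff k f) (w + ind S δ) -
        (∑ k ∈ S, rval (pdiff k (pdiff j f)) (w + ind S δ)) * rval f (w + ind S δ)) /
          rval f (w + ind S δ) ^ 2) ≤ rval (pdiff j f) w / rval f w := by
  obtain ⟨D, hD⟩ := hf.affine.exists_polynomial S (realPt w)
  obtain ⟨N, hN⟩ := (hf.affine.pdiff j).exists_polynomial S (realPt w)
  have hpt : ∀ s : ℝ, realPt w + ind S (s : ℂ) = realPt (w + ind S s) := fun s => by
    rw [realPt_add, realPt_ind]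
  have hcj : ∀ k, ∀ z, pdiff k f (fun a => conj (z a)) = conj (pdiff k f z) :=
    pdiff_conj hf.conj_apply
  have hDr : ∀ s : ℝ, D.eval (s : ℂ) = rval f (w + ind S s) := fun s => by
    rw [(hD s).1, hpt, apply_realPt hf.conj_apply]
  have hNr : ∀ s : ℝ, N.eval (s : ℂ) = rval (pdiff j f) (w + ind S s) := fun s => by
    rw [(hN s).1, hpt, apply_realPt (hcj j)]
  have hpos : ∀ s : ℝ, 0 ≤ s → w ≤ w + ind S s := fun s hs =>
    le_add_of_nonneg_right (ind_nonneg S hs)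
  have hD0 : D ≠ 0 := by
    rintro rfl
    have h1 := hDr 0
    have h2 := h _ (hpos 0 le_rfl)
    rw [eval_zero, eq_comm, Complex.ofReal_eq_zero] at h1
    exact h2.ne' h1
  -- Stability does not apply directly, since the coordinates off `S` are real. But the modulus
  -- grows with imaginary parts, so a zero at `s` forces zeros on the whole segment from `s` down to
  -- the real axis, and `D` would vanish identically.
  have hup : ∀ s : ℂ, 0 < s.im → D.eval s ≠ 0 := by
    intro s hs h0
    refine hD0 (eq_zero_of_infinite_isRoot D (Set.Infinite.mono (s := (fun b : ℝ =>
      (⟨s.re, b⟩ : ℂ)) '' Set.Icc 0 s.im) ?_ ((Set.Icc_infinite hs).image ?_)))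
    · rintro _ ⟨b, hb, rfl⟩
      have := hf.norm_le_norm_add_ind (z := realPt w + ind S (⟨s.re, b⟩ : ℂ)) (fun a => by
        simp only [realPt, Pi.add_apply, ind]
        split_ifs <;> simp [hb.1]) S (sub_nonneg.2 hb.2)
      have e : realPt w + ind S (⟨s.re, b⟩ : ℂ) + ind S (((s.im - b : ℝ) : ℂ) * Complex.I) =
          realPt w + ind S s := by
        funext a
        simp only [Pi.add_apply, ind]
        split_ifs
        · rw [add_assoc]
          congr 1
          apply Complex.ext <;> simp
        · simp
      rw [e, ← (hD s).1, ← (hD _).1, h0, norm_zero, norm_le_zero_iff] at this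
      exact this
    · intro b _ c _ hbc
      exact congrArg Complex.im hbc
  have hroot : ∀ s, D.eval s = 0 → s.im = 0 ∧ s.re < 0 := by
    intro s hs
    have him : s.im = 0 := by
      rcases lt_trichotomy s.im 0 with h1 | h1 | h1
      · refine absurd ?_ (hup (conj s) (by simpa using h1))
        rw [(hD _).1]
        have e : realPt w + ind S (conj s) = fun a => conj ((realPt w + ind S s) a) := by
          funext a
          simp only [Pi.add_apply, ind, realPt]
          split_ifs <;> simp
        rw [e, hf.conj_apply, ← (hD s).1, hs, map_zero]
      · exact h1
      · exact absurd hs (hup s h1)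
    refine ⟨him, ?_⟩
    by_contra hre
    have hs' : s = (s.re : ℂ) := Complex.ext rfl (by simp [him])
    rw [hs', hDr, Complex.ofReal_eq_zero] at hs
    exact (h _ (hpos _ (not_lt.1 hre))).ne' hs
  have ht := tangent_le_of_im_nonpos hD0 hroot (N := N) (fun s hs => by
    rw [(hD s).1, (hN s).1]
    refine hf.im_pdiff_mul_conj_nonpos (fun a => ?_) j
    simp only [realPt, Pi.add_apply, ind]
    split_ifs <;> simp [hs.le]) ⟨rval (pdiff j f) w / rval f w, fun s hs => by
      have h0 := h _ (hpos s hs)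
      rw [hDr, hNr, Complex.norm_real, Complex.norm_real, Real.norm_of_nonneg h0.le,
        Real.norm_of_nonneg (h.rval_pdiff_nonneg hf.affine j (hpos s hs)), ← div_le_iff₀ h0]
      exact h.ratio_le hf j le_rfl (hpos s hs)⟩ hδ
  have e1 : D.derivative.eval (δ : ℂ) =
      ((∑ k ∈ S, rval (pdiff k f) (w + ind S δ) : ℝ) : ℂ) := by
    rw [(hD _).2, hpt, Complex.ofReal_sum]
    exact Finset.sum_congr rfl fun k _ => apply_realPt (hcj k) _
  have e2 : N.derivative.eval (δ : ℂ) =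
      ((∑ k ∈ S, rval (pdiff k (pdiff j f)) (w + ind S δ) : ℝ) : ℂ) := by
    rw [(hN _).2, hpt, Complex.ofReal_sum]
    exact Finset.sum_congr rfl fun k _ => apply_realPt (pdiff_conj (hcj j) k) _
  have e3 : D.eval 0 = rval f w := by simpa [ind, Pi.add_def] using hDr 0
  have e4 : N.eval 0 = rval (pdiff j f) w := by simpa [ind, Pi.add_def] using hNr 0
  rw [e1, e2, e3, e4, hDr, hNr] at ht
  exact_mod_cast ht

/-- The barrier step: if the barrier of `f` at `w` in the direction of `K` is small, then
`w` is above the zeros of `(1 - ∑ k ∈ K, ∂_k) f`, whose barriers at `w + δ 1_K` are at most those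
of `f` at `w`. -/
theorem IsAbove.diffOp [Fintype ι] (hf : IsRealStable f) (h : IsAbove f w) (K : Finset ι)
    {δ : ℝ} (hδ : 0 < δ) (hΦ : ∑ k ∈ K, rval (pdiff k f) w / rval f w ≤ 1 - 1 / δ) :
    IsAbove (diffOp K f) (w + ind K δ) ∧
    ∀ j, rval (pdiff j (diffOp K f)) (w + ind K δ) / rval (diffOp K f) (w + ind K δ) ≤
      rval (pdiff j f) w / rval f w := by
  -- As the ratios decrease, the bound at `w` gives `∑ ∂_k f ≤ (1 - 1 / δ) f` on the whole orthant.
  have key : ∀ y, w ≤ y → rval f y ≤ δ * rval (_root_.diffOp K f) y := by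
    intro y hy
    have h0 := h y hy
    have h1 : ∑ k ∈ K, rval (pdiff k f) y / rval f y ≤ 1 - 1 / δ :=
      (Finset.sum_le_sum fun k _ => h.ratio_le hf k le_rfl hy).trans hΦ
    rw [← Finset.sum_div, div_le_iff₀ h0] at h1
    rw [rval_diffOp]
    have h2 := mul_le_mul_of_nonneg_left h1 hδ.le
    have h3 : δ * ((1 - 1 / δ) * rval f y) = δ * rval f y - rval f y := by
      field_simp
    linarith
  have hw : w ≤ w + ind K δ := le_add_of_nonneg_right (ind_nonneg K hδ.le)
  refine ⟨fun y hy => ?_, fun j => ?_⟩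
  · exact pos_of_mul_pos_right ((h y (hw.trans hy)).trans_le (key y (hw.trans hy))) hδ.le
  · refine le_trans ?_ (h.tangent_le hf K j hδ.le)
    have h0 := h _ hw
    have hk := key _ hw
    have hR : rval f (w + ind K δ) * ∑ k ∈ K, rval (pdiff k (pdiff j f)) (w + ind K δ) ≤
        (∑ k ∈ K, rval (pdiff k f) (w + ind K δ)) * rval (pdiff j f) (w + ind K δ) := by
      rw [Finset.mul_sum, Finset.sum_mul]
      exact Finset.sum_le_sum fun k _ => hf.rayleigh _ k j
    rw [pdiff_diffOp, rval_diffOp]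
    have hQ : 0 < rval (_root_.diffOp K f) (w + ind K δ) := by
      exact pos_of_mul_pos_right (h0.trans_le hk) hδ.le
    rw [rval_diffOp] at hQ hk ⊢
    set F := rval f (w + ind K δ)
    set Fj := rval (pdiff j f) (w + ind K δ)
    set A := ∑ k ∈ K, rval (pdiff k f) (w + ind K δ)
    set B := ∑ k ∈ K, rval (pdiff k (pdiff j f)) (w + ind K δ)
    -- The last term is minus the derivative of `∂_j f / f` along `K`, with one factor `F` of its
    -- denominator replaced by `F - A ≥ F / δ`. It is thus at most the `δ` term of the tangent
    -- inequality.
    have e : (Fj - B) / (F - A) = Fj / F + (Fj * A - B * F) / ((F - A) * F) := by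
      field_simp
      ring
    rw [e]
    refine add_le_add_right ?_ _
    rw [← mul_div_assoc, div_le_div_iff₀ (by positivity) (by positivity)]
    have hX : 0 ≤ Fj * A - B * F := by linarith
    have := mul_le_mul_of_nonneg_left hk (mul_nonneg hX h0.le)
    linarith

/-- If `f v ≤ 0`, then `f` increases in direction `b` and has a zero above `v`. Positivity of `f - ∑
∂_k f` at that zero gives some `∂_k f < 0`, while `∂_b f > 0`; the Rayleigh inequality there reads
`0 ≤ ∂_k f ∂_b f`. -/
theorem IsAbove.of_diffOp_of_add_single (hf : IsRealStable f) (K : Finset ι)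
    (hK : IsAbove (_root_.diffOp K f) w) (b : ι) {t : ℝ} (ht : 0 ≤ t)
    (h : IsAbove f (w + Pi.single b t)) : IsAbove f w := by
  intro v hv
  by_contra hneg
  have hneg := not_lt.1 hneg
  have h1 : 0 < rval f (v + Pi.single b t) := h _ (add_le_add_left hv _)
  rw [rval_add_single hf.affine] at h1
  have hb : 0 < rval (pdiff b f) v := pos_of_mul_pos_right (by linarith) ht
  set σ := -rval f v / rval (pdiff b f) v
  have hσ : 0 ≤ σ := div_nonneg (by linarith) hb.le
  have h0 : rval f (v + Pi.single b σ) = 0 := by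
    rw [rval_add_single hf.affine, div_mul_cancel₀ _ hb.ne']
    ring
  have hK' := hK _ (hv.trans (le_add_single v b hσ))
  rw [rval_diffOp, h0, zero_sub, neg_pos] at hK'
  obtain ⟨k, -, hk⟩ := Finset.exists_lt_of_sum_lt (s := K) (g := fun _ => (0 : ℝ))
    (hK'.trans_eq Finset.sum_const_zero.symm)
  have hR := hf.rayleigh (v + Pi.single b σ) k b
  rw [h0, zero_mul, rval_pdiff_add_single hf.affine] at hR
  exact absurd hR (not_le.2 (mul_neg_of_neg_of_pos hk hb))

theorem IsAbove.of_diffOp [Fintype ι] (hf : IsRealStable f) (K : Finset ι)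
    (hK : IsAbove (_root_.diffOp K f) w) {w' : ι → ℝ} (hw : w ≤ w') (h : IsAbove f w') :
    IsAbove f w := by
  refine of_single_steps (p := fun z => IsAbove f z → IsAbove f w) hw id
    (fun z b t hz ht ih hz' => ih ?_) h
  exact IsAbove.of_diffOp_of_add_single hf K (hK.mono hz) b ht hz'

/-! ### Compositions of the operators and the choice of shifts -/

/-- The composition of the operators `1 - ∑ k ∈ K i, ∂_k` over a list of indices `i`. -/
def diffOps {β : Type*} (K : β → Finset ι) : List β → ((ι → ℂ) → ℂ) → (ι → ℂ) → ℂ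
  | [], f => f
  | i :: l, f => _root_.diffOp (K i) (diffOps K l f)

variable {β : Type*} {K : β → Finset ι}

theorem IsRealStable.diffOps (hf : IsRealStable f) (l : List β) :
    IsRealStable (diffOps K l f) := by
  induction l with
  | nil => exact hf
  | cons i l ih => exact ih.diffOp (K i)

theorem diffOp_comp_add (S : Finset ι) (v : ι → ℂ) :
    _root_.diffOp S (fun z => f (z + v)) = fun z => _root_.diffOp S f (z + v) := by
  funext z
  simp only [_root_.diffOp, pdiff]
  congr 1
  refine Finset.sum_congr rfl fun k _ => ?_
  rw [add_right_comm]

theorem diffOps_comp_add (l : List β) (v : ι → ℂ) :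
    diffOps K l (fun z => f (z + v)) = fun z => diffOps K l f (z + v) := by
  induction l with
  | nil => rfl
  | cons i l ih => rw [diffOps, ih, diffOp_comp_add]; rfl

/-- No step raises a barrier, so the smallness assumed of `f` at `w` remains available for every
later operator. -/
theorem IsAbove.diffOps [Fintype ι] (hf : IsRealStable f) (h : IsAbove f w)
    {δ : ℝ} (hδ : 0 < δ)
    (hΦ : ∀ i, ∑ k ∈ K i, rval (pdiff k f) w / rval f w ≤ 1 - 1 / δ) (l : List β) :
    IsAbove (diffOps K l f) (w + (l.map fun i => ind (K i) δ).sum) ∧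
    ∀ j, rval (pdiff j (diffOps K l f)) (w + (l.map fun i => ind (K i) δ).sum) /
      rval (diffOps K l f) (w + (l.map fun i => ind (K i) δ).sum) ≤
      rval (pdiff j f) w / rval f w := by
  induction l with
  | nil => simpa [_root_.diffOps] using h
  | cons i l ih =>
    obtain ⟨h1, h2⟩ := ih
    have := h1.diffOp (hf.diffOps l) (K i) hδ
      ((Finset.sum_le_sum fun k _ => h2 k).trans (hΦ i))
    rw [List.map_cons, List.sum_cons, add_comm (ind (K i) δ), ← add_assoc]
    exact ⟨this.1, fun j => (this.2 j).trans (h2 j)⟩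

/-- The operator of `i` is the average of the shifts by `-r e_k`, `k ∈ K i`. Some `k` is good at
`w`, and monotonicity of the ratio makes it good on the orthant. This needs the function `g` before
the operator to be positive there too, which `IsAbove.of_diffOp` derives from positivity on some
distant orthant; hence `hfar`. The operators commute with translations, so the shift passes to `f`
and the induction continues. -/
theorem exists_shift_isAbove [Fintype ι] {r : ℕ} (hr : 0 < r) (hK : ∀ i, (K i).card = r)
    [DecidableEq β] (l : List β) (hl : l.Nodup) (hf : IsRealStable f)
    (hfar : ∀ l', ∃ w', w ≤ w' ∧ IsAbove (diffOps K l' f) w') (h : IsAbove (diffOps K l f) w) :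
    ∃ κ : β → ι, (∀ i, κ i ∈ K i) ∧
      IsAbove (fun z => f (z + realPt (l.map fun i => Pi.single (κ i) (-r : ℝ)).sum)) w := by
  induction l generalizing f with
  | nil =>
    have : ∀ i, ∃ k, k ∈ K i := fun i => Finset.card_pos.1 (by rw [hK]; exact hr)
    choose κ hκ using this
    refine ⟨κ, hκ, ?_⟩
    have e : realPt (0 : ι → ℝ) = 0 := by funext a; simp [realPt]
    simpa [e, _root_.diffOps] using h
  | cons i l ih =>
    obtain ⟨w', hw', hfar'⟩ := hfar l
    set g := diffOps K l f with hg
    have hgs : IsRealStable g := hf.diffOps l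
    have hgw : IsAbove g w := IsAbove.of_diffOp hgs (K i) h hw' hfar'
    have hsum : ∑ k ∈ K i, (0 : ℝ) < ∑ k ∈ K i, (rval g w - r * rval (pdiff k g) w) := by
      have h0 := h w le_rfl
      rw [diffOps, rval_diffOp] at h0
      rw [Finset.sum_const_zero, Finset.sum_sub_distrib, Finset.sum_const, hK, nsmul_eq_mul,
        ← Finset.mul_sum, ← mul_sub]
      positivity
    obtain ⟨k, hk, hpos⟩ := Finset.exists_lt_of_sum_lt hsum
    have e1 := fun l' => diffOps_comp_add (K := K) (f := f) l' (realPt (Pi.single k (-r : ℝ)))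
    have habove : IsAbove (diffOps K l fun z => f (z + realPt (Pi.single k (-r : ℝ)))) w := by
      intro y hy
      rw [e1, rval_comp_add, rval_add_single hgs.affine]
      have h1 := hgw.ratio_le hgs k le_rfl hy
      have h2 : r * (rval (pdiff k g) w / rval g w) < 1 := by
        rw [← mul_div_assoc, div_lt_one (hgw w le_rfl)]
        linarith
      have h3 := (mul_le_mul_of_nonneg_left h1 (Nat.cast_nonneg r)).trans_lt h2
      rw [← mul_div_assoc, div_lt_one (hgw y hy)] at h3
      linarith
    obtain ⟨κ, hκ, hκ'⟩ := ih (List.nodup_cons.1 hl).2 (hf.comp_add _) (fun l' => by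
      obtain ⟨w', hw', hfar'⟩ := hfar l'
      refine ⟨w' + Pi.single k (r : ℝ), hw'.trans (le_add_single _ _ (Nat.cast_nonneg r)), ?_⟩
      intro y hy
      rw [e1, rval_comp_add]
      refine hfar' _ ?_
      rw [Pi.single_neg, ← sub_eq_add_neg]
      exact le_sub_iff_add_le.2 hy) habove
    refine ⟨Function.update κ i k, fun j => ?_, ?_⟩
    · by_cases hj : j = i
      · subst hj; simpa using hk
      · simpa [hj] using hκ j
    · have e2 : (l.map fun j => Pi.single (M := fun _ => ℝ) (Function.update κ i k j) (-r : ℝ)) =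
          l.map fun j => Pi.single (M := fun _ => ℝ) (κ j) (-r : ℝ) := by
        refine List.map_congr_left fun j hj => ?_
        have : j ≠ i := fun h => (List.nodup_cons.1 hl).1 (h ▸ hj)
        rw [Function.update_of_ne this]
      intro y hy
      rw [List.map_cons, List.sum_cons, e2, Function.update_self]
      have := hκ' y hy
      simp only [rval] at this ⊢
      rwa [realPt_add, add_comm (realPt (Pi.single k _)), ← add_assoc]

end

/-! ### Rank-one matrices and determinants -/

section

open Matrix

variable {d : ℕ}

theorem posSemidef_rankOne (u : EuclideanSpace ℂ (Fin d)) : (rankOne u).PosSemidef :=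
  posSemidef_vecMulVec_self_star (fun a => u a)

theorem dotProduct_rankOne_mulVec (u : EuclideanSpace ℂ (Fin d)) (v : Fin d → ℂ) :
    star v ⬝ᵥ (rankOne u *ᵥ v) = (‖inner ℂ u (WithLp.toLp 2 v)‖ ^ 2 : ℝ) := by
  have h1 : (fun b => star (u b)) ⬝ᵥ v = inner ℂ u (WithLp.toLp 2 v) := by
    rw [PiLp.inner_apply]
    simp [dotProduct, mul_comm]
  have h2 : star v ⬝ᵥ (fun a => u a) = star (inner ℂ u (WithLp.toLp 2 v)) := by
    rw [← h1]
    simp [dotProduct, mul_comm]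
  rw [rankOne, vecMulVec_mulVec, h1]
  simp only [dotProduct_smul, op_smul_eq_smul, smul_eq_mul, h2]
  rw [Complex.ofReal_pow, ← Complex.mul_conj']
  rfl

theorem posSemidef_sq_norm_smul_one_sub_rankOne (u : EuclideanSpace ℂ (Fin d)) :
    ((‖u‖ ^ 2 : ℝ) • (1 : Matrix (Fin d) (Fin d) ℂ) - rankOne u).PosSemidef := by
  refine PosSemidef.of_dotProduct_mulVec_nonneg ?_ fun v => ?_
  · exact (isHermitian_one.smul (IsSelfAdjoint.all _)).sub (posSemidef_rankOne u).isHermitian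
  · have h1 : star v ⬝ᵥ v = (‖WithLp.toLp 2 v‖ ^ 2 : ℝ) := by
      rw [EuclideanSpace.norm_sq_eq]
      simp [dotProduct, Complex.conj_mul']
    rw [sub_mulVec, smul_mulVec, one_mulVec, dotProduct_sub, dotProduct_rankOne_mulVec,
      dotProduct_smul, h1, Complex.real_smul, ← Complex.ofReal_mul, ← Complex.ofReal_sub,
      Complex.zero_le_real, sub_nonneg, ← mul_pow]
    exact pow_le_pow_left₀ (norm_nonneg _) (norm_inner_le_norm _ _) 2

theorem posDef_real_smul_one {t : ℝ} (ht : 0 < t) :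
    (t • (1 : Matrix (Fin d) (Fin d) ℂ)).PosDef :=
  PosDef.one.smul ht

/-- The determinant is affine along rank-one perturbations. -/
theorem det_add_smul_rankOne (M : Matrix (Fin d) (Fin d) ℂ) (u : EuclideanSpace ℂ (Fin d))
    (t : ℂ) : (M + t • rankOne u).det = M.det + t * ((M + rankOne u).det - M.det) := by
  -- The perturbed determinant is that of a bordered matrix, by Schur complement, with last column
  -- `e + s • c`; the determinant is linear in this column.
  let c : Fin d ⊕ Unit → ℂ := Sum.elim (fun a => -u a) 0
  let e : Fin d ⊕ Unit → ℂ := Sum.elim 0 1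
  let N : Matrix (Fin d ⊕ Unit) (Fin d ⊕ Unit) ℂ :=
    fromBlocks M 0 (replicateRow Unit fun b => star (u b)) 1
  have key : ∀ s : ℂ, (M + s • rankOne u).det =
      (N.updateCol (Sum.inr ()) e).det + s * (N.updateCol (Sum.inr ()) c).det := by
    intro s
    have h1 : fromBlocks M (replicateCol Unit fun a => -(s * u a))
        (replicateRow Unit fun b => star (u b)) 1 = N.updateCol (Sum.inr ()) (e + s • c) := by
      ext i j
      rcases i with i | i <;> rcases j with j | j <;> simp [N, e, c]
    have h2 : M - (replicateCol Unit fun a => -(s * u a)) *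
        (replicateRow Unit fun b => star (u b)) = M + s • rankOne u := by
      ext i j
      simp [rankOne, vecMulVec_apply, Matrix.mul_apply, mul_assoc]
    rw [← h2, ← det_fromBlocks_one₂₂, h1, det_updateCol_add, det_updateCol_smul]
  have h0 := key 0
  have h1 := key 1
  rw [zero_smul, add_zero, zero_mul, add_zero] at h0
  rw [one_smul, one_mul] at h1
  rw [key t, h1, h0]
  ring

/-- An eigenvalue `l > x / r` would make the determinant vanish at `s = x / l < r`. -/
theorem norm_le_div_of_det_ne_zero {M : Matrix (Fin d) (Fin d) ℂ} (hM : M.PosSemidef) {x r : ℝ}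
    (hx : 0 < x) (hr : 0 < r)
    (h : ∀ s : ℝ, 0 ≤ s → s ≤ r → (x • (1 : Matrix (Fin d) (Fin d) ℂ) - s • M).det ≠ 0) :
    ‖M‖ ≤ x / r := by
  have hx' : 0 ≤ x / r := by positivity
  rw [CStarAlgebra.norm_le_iff_le_algebraMap M hx' (nonneg_iff_posSemidef.2 hM)]
  refine le_algebraMap_of_spectrum_le (fun l hl => ?_) hM.isHermitian
  by_contra hlt
  have hlt := not_le.1 hlt
  have hl0 : 0 < l := hx'.trans_lt hlt
  rw [spectrum.mem_iff] at hl
  have hs : 0 < x / l := by positivity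
  have h1 := h (x / l) hs.le ((div_le_iff₀ hl0).2 ((div_lt_iff₀ hr).1 hlt |>.le.trans_eq
    (mul_comm _ _)))
  have e : x • (1 : Matrix (Fin d) (Fin d) ℂ) - (x / l) • M =
      (x / l) • (algebraMap ℝ (Matrix (Fin d) (Fin d) ℂ) l - M) := by
    rw [smul_sub, Algebra.algebraMap_eq_smul_one, smul_smul, div_mul_cancel₀ _ hl0.ne']
  rw [e] at h1
  refine hl ((isUnit_iff_isUnit_det _).2 (isUnit_iff_ne_zero.2 fun h0 => h1 ?_))
  rw [det_smul_of_tower, h0, smul_zero]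

/-! ### The pencil and its block determinant -/

variable {m r : ℕ}

/-- The matrix pencil `x (1 - ∑ u_i u_i*) + ∑ z_i u_i u_i*`. -/
noncomputable def pencil (u : Fin m → EuclideanSpace ℂ (Fin d)) (x : ℝ) (z : Fin m → ℂ) :
    Matrix (Fin d) (Fin d) ℂ :=
  x • (1 - ∑ i, rankOne (u i)) + ∑ i, z i • rankOne (u i)

variable (u : Fin m → EuclideanSpace ℂ (Fin d))

theorem pencil_add_single (x : ℝ) (z : Fin m → ℂ) (i : Fin m) (t : ℂ) :
    pencil u x (z + Pi.single i t) = pencil u x z + t • rankOne (u i) := by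
  have : ∑ j, (Pi.single i t : Fin m → ℂ) j • rankOne (u j) = t • rankOne (u i) := by
    rw [Finset.sum_eq_single i] <;> simp +contextual
  simp only [pencil, Pi.add_apply, add_smul, Finset.sum_add_distrib, this, add_assoc]

/-- For `t ≤ x` and `t ≤ y i` this exhibits the pencil as `t` plus positive semidefinite terms; for
`t = x` the middle term disappears. -/
theorem pencil_realPt (x t : ℝ) (y : Fin m → ℝ) :
    pencil u x (realPt y) = t • 1 + (x - t) • (1 - ∑ i, rankOne (u i)) +
      ∑ i, (y i - t) • rankOne (u i) := by
  have : ∀ i, realPt y i • rankOne (u i) = (y i - t) • rankOne (u i) + t • rankOne (u i) :=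
    fun i => by rw [← add_smul, sub_add_cancel]; rfl
  simp only [pencil, this, Finset.sum_add_distrib, ← Finset.smul_sum, sub_smul, smul_sub]
  abel

/-- For a kernel vector `v`, the imaginary part of the quadratic form is `∑ Im z_i |⟨u_i, v⟩|²`, so
`v` is orthogonal to every `u_i`; what remains of the form is `x ‖v‖²`. -/
theorem det_pencil_ne_zero {x : ℝ} (hx : 0 < x) {z : Fin m → ℂ} (hz : ∀ i, 0 < (z i).im) :
    (pencil u x z).det ≠ 0 := by
  intro h
  obtain ⟨v, hv, hv0⟩ := exists_mulVec_eq_zero_iff.2 h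
  have h1 : star v ⬝ᵥ (pencil u x z *ᵥ v) = 0 := by rw [hv0, dotProduct_zero]
  set c : Fin m → ℝ := fun i => ‖inner ℂ (u i) (WithLp.toLp 2 v)‖ ^ 2
  have hc : ∀ i, star v ⬝ᵥ (rankOne (u i) *ᵥ v) = c i := fun i =>
    dotProduct_rankOne_mulVec (u i) v
  have hc0 : ∀ i, 0 ≤ c i := fun i => by positivity
  have hvv : star v ⬝ᵥ v = (‖WithLp.toLp 2 v‖ ^ 2 : ℝ) := by
    rw [EuclideanSpace.norm_sq_eq]
    simp [dotProduct, Complex.conj_mul']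
  rw [pencil, add_mulVec, dotProduct_add, smul_mulVec, sub_mulVec, one_mulVec, sum_mulVec,
    sum_mulVec, dotProduct_smul, dotProduct_sub, dotProduct_sum, dotProduct_sum, hvv] at h1
  simp only [smul_mulVec, dotProduct_smul, hc, smul_eq_mul] at h1
  have him := congrArg Complex.im h1
  rw [← Complex.ofReal_sum, ← Complex.ofReal_sub, Complex.real_smul, ← Complex.ofReal_mul,
    Complex.add_im, Complex.ofReal_im, zero_add, Complex.im_sum, Complex.zero_im] at him
  simp only [Complex.im_mul_ofReal] at him
  rw [Finset.sum_eq_zero_iff_of_nonneg fun i _ => mul_nonneg (hz i).le (hc0 i)] at him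
  have hci : ∀ i, c i = 0 := fun i =>
    (mul_eq_zero.1 (him i (Finset.mem_univ i))).resolve_left (hz i).ne'
  simp only [hci, Complex.ofReal_zero, mul_zero, Finset.sum_const_zero, sub_zero, add_zero,
    smul_eq_zero, hx.ne', false_or, Complex.ofReal_eq_zero] at h1
  have h2 : WithLp.toLp 2 v = 0 := norm_eq_zero.1 (pow_eq_zero_iff two_ne_zero |>.1 h1)
  exact hv (by simpa using h2)

open ComplexConjugate in
theorem pencil_conj (x : ℝ) (z : Fin m → ℂ) :
    pencil u x (fun i => conj (z i)) = (pencil u x z)ᴴ := by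
  have h : ∀ i, (rankOne (u i))ᴴ = rankOne (u i) := fun i => (posSemidef_rankOne (u i)).isHermitian
  simp only [pencil, conjTranspose_add, conjTranspose_smul, conjTranspose_sub, conjTranspose_sum,
    conjTranspose_one, h, star_trivial]
  rfl

/-- The product over `k` of the determinants of the pencils in the variables `z (i, k)`. -/
noncomputable def blockDet (r : ℕ) (x : ℝ) (z : Fin m × Fin r → ℂ) : ℂ :=
  ∏ k, (pencil u x fun i => z (i, k)).det

theorem isRealStable_blockDet (r : ℕ) {x : ℝ} (hx : 0 < x) : IsRealStable (blockDet u r x) where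
  affine z a t := by
    obtain ⟨i, k⟩ := a
    have h1 : ∀ s : ℂ, blockDet u r x (z + Pi.single (i, k) s) =
        (pencil u x (fun j => z (j, k)) + s • rankOne (u i)).det *
          ∏ l ∈ Finset.univ.erase k, (pencil u x fun j => z (j, l)).det := by
      intro s
      rw [blockDet, ← Finset.mul_prod_erase _ _ (Finset.mem_univ k)]
      congr 1
      · rw [← pencil_add_single]
        congr 2
        funext j
        simp [Pi.single_apply]
      · refine Finset.prod_congr rfl fun l hl => ?_
        congr 2
        funext j
        simp [Finset.ne_of_mem_erase hl]
    have h0 := h1 0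
    rw [Pi.single_zero, add_zero, zero_smul, add_zero] at h0
    rw [pdiff, h1, h1, h0, one_smul, det_add_smul_rankOne]
    ring
  cont := by
    unfold blockDet pencil
    refine continuous_finsetProd _ fun k _ => Continuous.matrix_det ?_
    fun_prop
  conj_apply z := by
    simp only [blockDet, map_prod]
    refine Finset.prod_congr rfl fun k _ => ?_
    rw [pencil_conj u x fun i => z (i, k), det_conjTranspose]
    rfl
  ne_zero z hz := Finset.prod_ne_zero_iff.2 fun k _ => det_pencil_ne_zero u hx fun i => hz (i, k)

theorem rval_blockDet_pos {x : ℝ} {y : Fin m × Fin r → ℝ}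
    (h : ∀ k, (pencil u x (realPt fun i => y (i, k))).PosDef) : 0 < rval (blockDet u r x) y := by
  have h1 : 0 < blockDet u r x (realPt y) := Finset.prod_pos fun k _ => (h k).det_pos
  exact (Complex.lt_def.1 h1).1

variable {u}

theorem isAbove_blockDet {x t : ℝ} (ht : 0 < t) (htx : t ≤ x)
    (hsum : ∑ i, rankOne (u i) ≤ (1 : Matrix (Fin d) (Fin d) ℂ)) :
    IsAbove (blockDet u r x) fun _ => t := by
  intro y hy
  refine rval_blockDet_pos u fun k => ?_
  rw [pencil_realPt u x t]
  refine ((posDef_real_smul_one ht).add_posSemidef ?_).add_posSemidef ?_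
  · exact (Matrix.le_iff.1 hsum).smul (sub_nonneg.2 htx)
  · exact posSemidef_sum _ fun i _ => (posSemidef_rankOne (u i)).smul (sub_nonneg.2 (hy (i, k)))

/-- If the ratio `q` exceeded `δ / t`, lowering coordinate `a` by `q⁻¹` would bring the affine
function to zero. Yet the pencils remain positive definite there, because `q⁻¹ u u* ≤ q⁻¹ ‖u‖² < t`.
-/
theorem ratio_blockDet_le {x t δ : ℝ} (ht : 0 < t) (htx : t ≤ x) (hδ : 0 < δ)
    (hsum : ∑ i, rankOne (u i) ≤ (1 : Matrix (Fin d) (Fin d) ℂ)) (hu : ∀ i, ‖u i‖ ^ 2 ≤ δ)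
    (a : Fin m × Fin r) :
    rval (pdiff a (blockDet u r x)) (fun _ => t) / rval (blockDet u r x) (fun _ => t) ≤ δ / t := by
  obtain ⟨i, k⟩ := a
  have hst := isRealStable_blockDet u r (ht.trans_le htx)
  have hpos := isAbove_blockDet (r := r) ht htx hsum _ le_rfl
  by_contra hlt
  have hlt := not_le.1 hlt
  set q := rval (pdiff (i, k) (blockDet u r x)) (fun _ => t) /
    rval (blockDet u r x) (fun _ => t) with hq
  have hq0 : 0 < q := (by positivity : 0 < δ / t).trans hlt
  have h1 : 0 < rval (blockDet u r x) ((fun _ => t) + Pi.single (i, k) (-q⁻¹)) := by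
    refine rval_blockDet_pos u fun l => ?_
    rw [pencil_realPt u x t]
    have hc : q⁻¹ * ‖u i‖ ^ 2 < t := by
      rw [div_lt_iff₀ ht] at hlt
      rw [inv_mul_lt_iff₀ hq0]
      exact (hu i).trans_lt hlt
    have e : t • (1 : Matrix (Fin d) (Fin d) ℂ) + (x - t) • (1 - ∑ i, rankOne (u i)) +
        ∑ j, (((fun _ => t) + Pi.single (i, k) (-q⁻¹) : Fin m × Fin r → ℝ) (j, l) - t) •
          rankOne (u j) =
        (t - q⁻¹ * ‖u i‖ ^ 2) • 1 + (q⁻¹ * ‖u i‖ ^ 2) • 1 -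
          (if l = k then q⁻¹ else 0) • rankOne (u i) + (x - t) • (1 - ∑ i, rankOne (u i)) := by
      have h2 : ∑ j, (((fun _ => t) + Pi.single (i, k) (-q⁻¹) : Fin m × Fin r → ℝ) (j, l) - t) •
          rankOne (u j) = -((if l = k then q⁻¹ else 0) • rankOne (u i)) := by
        rw [Finset.sum_eq_single i]
        · by_cases hl : l = k <;> simp [hl]
        · intro j _ hj
          simp [hj]
        · simp
      rw [h2, ← add_smul, sub_add_cancel]
      abel
    rw [e, add_sub_assoc]
    refine ((posDef_real_smul_one (sub_pos.2 hc)).add_posSemidef ?_).add_posSemidef ?_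
    · split_ifs
      · rw [mul_smul, ← smul_sub]
        exact (posSemidef_sq_norm_smul_one_sub_rankOne (u i)).smul (by positivity)
      · rw [zero_smul, sub_zero]
        exact PosSemidef.one.smul (by positivity)
    · exact (Matrix.le_iff.1 hsum).smul (sub_nonneg.2 htx)
  rw [rval_add_single hst.affine] at h1
  have h2 : rval (pdiff (i, k) (blockDet u r x)) (fun _ => t) =
      q * rval (blockDet u r x) (fun _ => t) := by
    rw [hq, div_mul_cancel₀ _ hpos.ne']
  rw [h2, neg_mul, inv_mul_cancel_left₀ hq0.ne'] at h1
  linarith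

/-! ### Choice of the partition -/

/-- The expected-characteristic-polynomial argument: a choice of parts `c` whose shifted
block determinant has no zeros above `(1 + √ε)²`. -/
theorem exists_coloring (hr : 0 < r) {δ : ℝ} (hδ : 0 < δ)
    (hsum : ∑ i, rankOne (u i) ≤ (1 : Matrix (Fin d) (Fin d) ℂ)) (hu : ∀ i, ‖u i‖ ^ 2 ≤ δ) :
    ∃ c : Fin m → Fin r, ∀ y : Fin m × Fin r → ℝ, 0 ≤ y →
      0 < rval (blockDet u r ((1 + √(r * δ)) ^ 2)) fun p =>
        (1 + √(r * δ)) ^ 2 + y p - if c p.1 = p.2 then (r : ℝ) else 0 := by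
  have hr' : (0 : ℝ) < r := by exact_mod_cast hr
  have hε : 0 < r * δ := by positivity
  set e := √(r * δ) with he
  have he0 : 0 < e := Real.sqrt_pos.2 hε
  have hee : e ^ 2 = r * δ := Real.sq_sqrt hε.le
  set x := (1 + e) ^ 2 with hx
  have hx0 : 0 < x := by positivity
  -- This makes `r * δ / t = 1 - 1 / (1 + e)`, exactly the barrier allowed for a step of length `1 +
  -- e`, and `t + (1 + e) = x`.
  set t := e + e ^ 2 with ht
  have ht0 : 0 < t := by positivity
  have htx : t ≤ x := by rw [ht, hx]; nlinarith
  let K : Fin m → Finset (Fin m × Fin r) := fun i => {i} ×ˢ Finset.univ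
  have hK : ∀ i, (K i).card = r := fun i => by simp [K]
  have hmem : ∀ i p, p ∈ K i ↔ p.1 = i := fun i p => by
    rw [Finset.mem_product]; simp
  have hst := isRealStable_blockDet u r hx0
  have hab := isAbove_blockDet (r := r) ht0 htx hsum
  have hΦ : ∀ i, ∑ k ∈ K i, rval (pdiff k (blockDet u r x)) (fun _ => t) /
      rval (blockDet u r x) (fun _ => t) ≤ 1 - 1 / (1 + e) := by
    intro i
    refine (Finset.sum_le_card_nsmul _ _ _ fun a _ =>
      ratio_blockDet_le ht0 htx hδ hsum hu a).trans_eq ?_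
    rw [hK, nsmul_eq_mul, ← mul_div_assoc, ← hee, ht]
    field_simp
    ring
  have hb := fun l => (hab.diffOps hst (by positivity) hΦ l).1
  -- The sets `K i` partition the coordinates, so each coordinate is raised exactly once, from `t`
  -- to `x`.
  have htop : IsAbove (diffOps K (List.finRange m) (blockDet u r x)) fun _ => x := by
    convert hb (List.finRange m) using 1
    rw [← Fin.sum_univ_def]
    funext p
    have : ∀ i, ind (K i) (1 + e) p = if p.1 = i then 1 + e else 0 := fun i => by
      simp only [ind, hmem]
    rw [Pi.add_apply, Finset.sum_apply]
    simp only [this, Finset.sum_ite_eq, Finset.mem_univ, if_true]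
    rw [hx, ht]; ring
  -- The distant corner required for each list is the supremum of its barrier corner and `x`.
  obtain ⟨κ, hκ, hκ'⟩ := exists_shift_isAbove hr hK (List.finRange m) (List.nodup_finRange m) hst
    (fun l => ⟨_, le_sup_right, (hb l).mono le_sup_left⟩) htop
  refine ⟨fun i => (κ i).2, fun y hy => ?_⟩
  have h := hκ' ((fun _ => x) + y) (le_add_of_nonneg_right hy)
  rw [rval_comp_add] at h
  convert h using 2
  rw [← Fin.sum_univ_def]
  funext p
  have hκ1 : ∀ i, (κ i).1 = i := fun i => (hmem i _).1 (hκ i)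
  rw [Pi.add_apply, Pi.add_apply, Finset.sum_apply, Finset.sum_eq_single p.1]
  · have : p = κ p.1 ↔ (κ p.1).2 = p.2 := by
      rw [Prod.ext_iff, hκ1]
      simp [eq_comm]
    simp only [Pi.single_apply, this]
    split_ifs <;> ring
  · intro i _ hi
    rw [Pi.single_apply, if_neg]
    rintro rfl
    exact hi (hκ1 i).symm
  · simp

theorem norm_sum_rankOne_le (hr : 0 < r) {δ : ℝ} (hδ : 0 < δ)
    (hsum : ∑ i, rankOne (u i) ≤ (1 : Matrix (Fin d) (Fin d) ℂ)) (hu : ∀ i, ‖u i‖ ^ 2 ≤ δ) :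
    ∃ c : Fin m → Fin r, ∀ k, ‖∑ i with c i = k, rankOne (u i)‖ ≤
      (1 + √(r * δ)) ^ 2 / r := by
  obtain ⟨c, hc⟩ := exists_coloring hr hδ hsum hu
  have hr' : (0 : ℝ) < r := by exact_mod_cast hr
  refine ⟨c, fun k => norm_le_div_of_det_ne_zero
    (posSemidef_sum _ fun i _ => posSemidef_rankOne (u i)) (by positivity) hr' fun s hs hsr h0 => ?_⟩
  -- The chosen coordinates become `x + (r - s) - r = x - s` and the others stay at `x`, where `x =
  -- (1 + √(r * δ)) ^ 2`; the factor of part `k` is then the determinant in `h0`.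
  have h := hc (fun p => if c p.1 = p.2 then r - s else 0) (fun p => by
    dsimp only [Pi.zero_apply]; split_ifs <;> linarith)
  refine h.ne' ?_
  have : blockDet u r ((1 + √(r * δ)) ^ 2) (realPt fun p => (1 + √(r * δ)) ^ 2 +
      (if c p.1 = p.2 then (r : ℝ) - s else 0) - if c p.1 = p.2 then (r : ℝ) else 0) = 0 := by
    refine Finset.prod_eq_zero (Finset.mem_univ k) ?_
    convert h0 using 2
    refine (pencil_realPt u _ ((1 + √(r * δ)) ^ 2) _).trans ?_
    rw [sub_self, zero_smul, add_zero,
      sub_eq_add_neg (((1 + √(r * δ)) ^ 2) • (1 : Matrix (Fin d) (Fin d) ℂ)),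
      Finset.smul_sum, Finset.sum_filter,
      ← Finset.sum_neg_distrib]
    congr 1
    refine Finset.sum_congr rfl fun i _ => ?_
    by_cases hi : c i = k
    · simp only [hi, if_true, ← neg_smul]
      congr 1
      ring
    · simp [hi]
  rw [rval, this, Complex.zero_re]

end

/-- Here `≤` between matrices is the Loewner order (the difference is positive semidefinite), the
norm of a vector is the Euclidean one, and the norm of a matrix is the operator norm induced by it.
A partition into `r` parts is a family of `r` pairwise disjoint, possibly empty sets that cover the
index set. -/
theorem corollary2 (d m r : ℕ) (hr : 0 < r) (δ : ℝ) (hδ : 0 ≤ δ)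
    (u : Fin m → EuclideanSpace ℂ (Fin d))
    (hsum : ∑ i, rankOne (u i) ≤ (1 : Matrix (Fin d) (Fin d) ℂ))
    (hu : ∀ i, ‖u i‖ ^ 2 ≤ δ) :
    ∃ S : Fin r → Finset (Fin m),
      (∀ k l, k ≠ l → Disjoint (S k) (S l)) ∧
      (∀ i, ∃ k, i ∈ S k) ∧
      ∀ k, ‖∑ i ∈ S k, rankOne (u i)‖ ≤ (1 / (r : ℝ)) * (1 + √((r : ℝ) * δ)) ^ 2 := by
  suffices h : ∃ c : Fin m → Fin r, ∀ k, ‖∑ i with c i = k, rankOne (u i)‖ ≤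
      (1 + √(r * δ)) ^ 2 / r by
    obtain ⟨c, hc⟩ := h
    refine ⟨fun k => {i | c i = k}, fun k l hkl => ?_, fun i => ⟨c i, by simp⟩, fun k => ?_⟩
    · rw [Finset.disjoint_filter]
      rintro i - rfl
      exact hkl
    · rw [one_div_mul_eq_div]
      exact hc k
  -- The barrier argument starts at `t = √(rδ) + rδ`, which must be positive; for `δ = 0` all the
  -- vectors vanish.
  rcases hδ.eq_or_lt with rfl | hδ
  · have h0 : ∀ i, rankOne (u i) = 0 := fun i => by
      have : u i = 0 := norm_eq_zero.1 (pow_eq_zero_iff two_ne_zero |>.1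
        (le_antisymm (hu i) (by positivity)))
      ext a b
      simp [this, rankOne, Matrix.vecMulVec_apply]
    refine ⟨fun _ => ⟨0, hr⟩, fun k => ?_⟩
    simp only [h0, Finset.sum_const_zero, norm_zero]
    positivity
  · exact norm_sum_rankOne_le hr hδ hsum hu
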